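/- Let $n \ge 2$, let $\Omega \subset \mathbb{R}^n$ be a bounded open set and let $1 < p \le q < \infty$, $0 < \ell < L$, $\nu > 0$. Let $F : \mathbb{R}^n \to \mathbb{R}$ be a $C^1$ function such that, for all $\xi, \eta \in \mathbb{R}^n$, $$\ell |\xi|^p \le F(\xi) \le L (1 + |\xi|^q), \tag{H1}$$ $$\nu\, |V_p(\xi) - V_p(\eta)|^2 \le F(\xi) - F(\eta) - \langle F'(\eta), \xi - \eta \rangle, \qquad V_p(\xi) := (1 + |\xi|^2)^{\frac{p-2}{4}} \xi, \tag{H2}$$ and such that for every $\lambda > 1$ there is a constant $C(\lambda)$ with $$F(\lambda \xi) \le C(\lambda) F(\xi) \quad \text{for all } \xi \in \mathbb{R}^n. \tag{H3}$$ No restriction on the ratio $q/p$ is imposed. Let $\psi : \Omega \to [-\infty, \infty)$ (the obstacle) and $u_0 : \Omega \to \mathbb{R}$ (the boundary datum) be weakly differentiable on $\Omega$, i.e. in $W^{1,1}_{\mathrm{loc}}(\Omega)$ (in particular $\psi$ is finite a.e.), with $F(D\psi) \in L^1(\Omega)$ and $F(Du_0) \in L^1(\Omega)$. Put $$\mathbb{K}^F_\psi(\Omega)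 := \{ z \in u_0 + W^{1,p}_0(\Omega) : z \ge \psi \text{ a.e. in } \Omega, \ F(Dz) \in L^1(\Omega) \},$$ where $W^{1,p}_0(\Omega)$ is the closure of $C^\infty_c(\Omega)$ in $W^{1,p}(\Omega)$, and let $F^*(\zeta) := \sup_{\xi \in \mathbb{R}^n} ( \langle \zeta, \xi \rangle - F(\xi) )$ be the Fenchel conjugate of $F$. Let $u \in \mathbb{K}^F_\psi(\Omega)$ be a solution of the obstacle problem, that is, $\int_\Omega F(Du)\,dx \le \int_\Omega F(Dz)\,dx$ for all $z \in \mathbb{K}^F_\psi(\Omega)$. Then $$F^*(F'(Du)) \in L^1(\Omega), \qquad \langle F'(Du), Du \rangle \in L^1(\Omega),$$ and $\operatorname{div} F'(Du) \le 0$ in $\Omega$ in the sense of distributions, i.e. $F'(Du) \in L^1_{\mathrm{loc}}(\Omega; \mathbb{R}^n)$ and $\int_\Omega \langle F'(Du), D\varphi \rangle \, dx \ge 0$ for every $\varphi \in C^\infty_c(\Omega)$ with $\varphi \ge 0$. Moreover, for every $z \in \mathbb{K}^F_\psi(\Omega)$ with $F(Dz) \in L^1(\Omega)$ and $F(-Dz)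 \in L^1(\Omega)$, the function $\langle F'(Du), Dz - Du \rangle$ is in $L^1(\Omega)$ and $$\int_\Omega \langle F'(Du), Dz - Du \rangle \, dx \ge 0.$$ -/

import Mathlib

open MeasureTheory TopologicalSpace
open scoped Topology Distributions Gradient

namespace ObstacleProblem

/-- `g` is the weak gradient of `v` on the open set `Ω`: both are locally integrable on `Ω` and
`∫_Ω v ∇φ = - ∫_Ω φ g` for every smooth `φ` with compact support in `Ω`. -/
structure HasWeakGrad {n : ℕ} (Ω : Opens (EuclideanSpace ℝ (Fin n)))
    (v : EuclideanSpace ℝ (Fin n) → ℝ)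
    (g : EuclideanSpace ℝ (Fin n) → EuclideanSpace ℝ (Fin n)) : Prop where
  locallyIntegrable : LocallyIntegrableOn v Ω volume
  locallyIntegrable_grad : LocallyIntegrableOn g Ω volume
  integral_eq : ∀ φ : 𝓓(Ω, ℝ),
    ∫ x in (Ω : Set (EuclideanSpace ℝ (Fin n))), v x • ∇ φ x
      = - ∫ x in (Ω : Set (EuclideanSpace ℝ (Fin n))), φ x • g x

/-- `v` is weakly differentiable on `Ω`, that is, `v ∈ W^{1,1}_loc(Ω)`. -/
def WeaklyDifferentiable {n : ℕ} (Ω : Opens (EuclideanSpace ℝ (Fin n)))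
    (v : EuclideanSpace ℝ (Fin n) → ℝ) : Prop :=
  ∃ g, HasWeakGrad Ω v g

open Classical in
/-- The weak gradient `Dv` on `Ω` (`0` if `v` is not weakly differentiable on `Ω`). -/
noncomputable def weakGrad {n : ℕ} (Ω : Opens (EuclideanSpace ℝ (Fin n)))
    (v : EuclideanSpace ℝ (Fin n) → ℝ) :
    EuclideanSpace ℝ (Fin n) → EuclideanSpace ℝ (Fin n) :=
  if h : WeaklyDifferentiable Ω v then h.choose else 0

theorem WeaklyDifferentiable.hasWeakGrad {n : ℕ} {Ω : Opens (EuclideanSpace ℝ (Fin n))}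
    {v : EuclideanSpace ℝ (Fin n) → ℝ} (h : WeaklyDifferentiable Ω v) :
    HasWeakGrad Ω v (weakGrad Ω v) := by
  rw [weakGrad, dif_pos h]
  exact h.choose_spec

/-- Weak gradients are unique up to null sets. -/
theorem HasWeakGrad.ae_eq {n : ℕ} {Ω : Opens (EuclideanSpace ℝ (Fin n))}
    {v : EuclideanSpace ℝ (Fin n) → ℝ}
    {g h : EuclideanSpace ℝ (Fin n) → EuclideanSpace ℝ (Fin n)}
    (hg : HasWeakGrad Ω v g) (hh : HasWeakGrad Ω v h) :
    ∀ᵐ x ∂(volume.restrict (Ω : Set (EuclideanSpace ℝ (Fin n)))), g x = h x := by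
  have hint : ∀ {k : EuclideanSpace ℝ (Fin n) → EuclideanSpace ℝ (Fin n)},
      LocallyIntegrableOn k Ω volume → ∀ φ : 𝓓(Ω, ℝ), Integrable (fun x => φ x • k x) volume := by
    intro k hk φ
    have h1 : IntegrableOn k (tsupport φ) volume :=
      hk.integrableOn_compact_subset φ.tsupport_subset φ.hasCompactSupport
    have h2 : IntegrableOn (fun x => φ x • k x) (tsupport φ) volume :=
      h1.continuousOn_smul φ.continuous.continuousOn φ.hasCompactSupport
    refine (integrableOn_iff_integrable_of_support_subset ?_).1 h2
    intro x hx
    refine subset_tsupport φ ?_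
    intro h0
    exact hx (by simp [h0])
  have hset : ∀ {k : EuclideanSpace ℝ (Fin n) → EuclideanSpace ℝ (Fin n)} (φ : 𝓓(Ω, ℝ)),
      ∫ x in (Ω : Set (EuclideanSpace ℝ (Fin n))), φ x • k x = ∫ x, φ x • k x := by
    intro k φ
    refine setIntegral_eq_integral_of_forall_compl_eq_zero ?_
    intro x hx
    have : φ x = 0 := image_eq_zero_of_notMem_tsupport fun hx' => hx (φ.tsupport_subset hx')
    simp [this]
  rw [ae_restrict_iff' Ω.isOpen.measurableSet]
  have key := Ω.isOpen.ae_eq_zero_of_integral_contDiff_smul_eq_zero (f := g - h) (μ := volume)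
    (hg.locallyIntegrable_grad.sub hh.locallyIntegrable_grad) (by
      intro φ h1 h2 h3
      let φ' : 𝓓(Ω, ℝ) := ⟨φ, h1, h2, h3⟩
      have e := (hg.integral_eq φ').symm.trans (hh.integral_eq φ')
      rw [neg_inj, hset, hset] at e
      have : ∫ x, φ' x • g x - φ' x • h x = 0 := by
        rw [integral_sub (hint hg.locallyIntegrable_grad φ') (hint hh.locallyIntegrable_grad φ'),
          e, sub_self]
      simp only [Pi.sub_apply, smul_sub]
      exact this)
  filter_upwards [key] with x hx hxΩ
  exact sub_eq_zero.1 (hx hxΩ)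

/-- The space `W^{1,p}_0(Ω)`: the closure of `C_c^∞(Ω)` in `W^{1,p}(Ω)`. -/
structure MemW1p0 {n : ℕ} (p : ℝ) (Ω : Opens (EuclideanSpace ℝ (Fin n)))
    (v : EuclideanSpace ℝ (Fin n) → ℝ) : Prop where
  weaklyDifferentiable : WeaklyDifferentiable Ω v
  memLp : MemLp v (ENNReal.ofReal p)
    (volume.restrict (Ω : Set (EuclideanSpace ℝ (Fin n))))
  memLp_grad : MemLp (weakGrad Ω v) (ENNReal.ofReal p)
    (volume.restrict (Ω : Set (EuclideanSpace ℝ (Fin n))))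
  approx : ∃ φ : ℕ → 𝓓(Ω, ℝ),
    Filter.Tendsto (fun k => eLpNorm (fun x => v x - φ k x) (ENNReal.ofReal p)
      (volume.restrict (Ω : Set (EuclideanSpace ℝ (Fin n))))) Filter.atTop (𝓝 0) ∧
    Filter.Tendsto (fun k => eLpNorm (fun x => weakGrad Ω v x - ∇ (φ k) x) (ENNReal.ofReal p)
      (volume.restrict (Ω : Set (EuclideanSpace ℝ (Fin n))))) Filter.atTop (𝓝 0)

/-- The finite-energy obstacle class
`{z ∈ u₀ + W^{1,p}_0(Ω) : z ≥ ψ a.e. in Ω, F(Dz) ∈ L¹(Ω)}`. -/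
def obstacleClass {n : ℕ} (p : ℝ) (Ω : Opens (EuclideanSpace ℝ (Fin n)))
    (F : EuclideanSpace ℝ (Fin n) → ℝ) (u₀ : EuclideanSpace ℝ (Fin n) → ℝ)
    (ψ : EuclideanSpace ℝ (Fin n) → EReal) : Set (EuclideanSpace ℝ (Fin n) → ℝ) :=
  {z | MemW1p0 p Ω (fun x => z x - u₀ x) ∧
    (∀ᵐ x ∂(volume.restrict (Ω : Set (EuclideanSpace ℝ (Fin n)))), ψ x ≤ (z x : EReal)) ∧
    IntegrableOn (fun x => F (weakGrad Ω z x)) Ω volume}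

/-- The auxiliary function `V_p(ξ) = (1 + |ξ|²)^{(p-2)/4} ξ`. -/
noncomputable def auxV {n : ℕ} (p : ℝ) (ξ : EuclideanSpace ℝ (Fin n)) :
    EuclideanSpace ℝ (Fin n) :=
  (1 + ‖ξ‖ ^ 2) ^ ((p - 2) / 4) • ξ

/-- The Fenchel conjugate `F^*(ζ) = sup_ξ (⟨ζ, ξ⟩ - F ξ)`. For `F` of superlinear growth the
supremum is finite, see `isLUB_fenchelConj`. -/
noncomputable def fenchelConj {n : ℕ} (F : EuclideanSpace ℝ (Fin n) → ℝ)
    (ζ : EuclideanSpace ℝ (Fin n)) : ℝ :=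
  ⨆ ξ : EuclideanSpace ℝ (Fin n), (inner ℝ ζ ξ - F ξ)

theorem isLUB_fenchelConj {n : ℕ} {F : EuclideanSpace ℝ (Fin n) → ℝ} {p l : ℝ} (hp : 1 < p)
    (hl : 0 < l) (hF : ∀ ξ, l * ‖ξ‖ ^ p ≤ F ξ) (ζ : EuclideanSpace ℝ (Fin n)) :
    IsLUB (Set.range fun ξ : EuclideanSpace ℝ (Fin n) => inner ℝ ζ ξ - F ξ)
      (fenchelConj F ζ) := by
  refine isLUB_ciSup ?_
  have hp0 : 0 < p := by linarith
  have hpq : p.HolderConjugate p.conjExponent := Real.HolderConjugate.conjExponent hp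
  set c : ℝ := (l * p) ^ (1 / p) with hc
  have hc0 : 0 < c := by positivity
  have hcp : c ^ p = l * p := by
    rw [hc, ← Real.rpow_mul (by positivity), one_div, inv_mul_cancel₀ hp0.ne', Real.rpow_one]
  refine ⟨(‖ζ‖ / c) ^ p.conjExponent / p.conjExponent, ?_⟩
  rintro _ ⟨ξ, rfl⟩
  have h1 : inner ℝ ζ ξ ≤ ‖ζ‖ * ‖ξ‖ := real_inner_le_norm ζ ξ
  have h2 := Real.young_inequality_of_nonneg (a := c * ‖ξ‖) (b := ‖ζ‖ / c) (by positivity)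
    (by positivity) hpq
  rw [Real.mul_rpow hc0.le (norm_nonneg _), hcp] at h2
  have h3 : l * p * ‖ξ‖ ^ p / p = l * ‖ξ‖ ^ p := by field_simp
  have h4 : c * ‖ξ‖ * (‖ζ‖ / c) = ‖ζ‖ * ‖ξ‖ := by field_simp
  have h5 := hF ξ
  rw [h3, h4] at h2
  show inner ℝ ζ ξ - F ξ ≤ _
  linarith

/-- `div σ ≤ 0` in the sense of distributions on `Ω`: `σ` is locally integrable on `Ω`, and the
distribution `⟨div σ, φ⟩ = - ∫_Ω ⟨σ, ∇φ⟩` is nonpositive on nonnegative test functions. -/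
def DivNonpos {n : ℕ} (Ω : Opens (EuclideanSpace ℝ (Fin n)))
    (σ : EuclideanSpace ℝ (Fin n) → EuclideanSpace ℝ (Fin n)) : Prop :=
  LocallyIntegrableOn σ Ω volume ∧
    ∀ φ : 𝓓(Ω, ℝ), (∀ x, 0 ≤ φ x) →
      - ∫ x in (Ω : Set (EuclideanSpace ℝ (Fin n))), inner ℝ (σ x) (∇ φ x) ≤ 0

end ObstacleProblem

open ObstacleProblem

/-!
The `Δ₂`-type condition makes the two integrability claims pointwise facts. The first-order
convexity inequality `⟨F'(η), ξ - η⟩ ≤ F(ξ) - F(η)` at `ξ = 2η` gives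
`⟨F'(η), η⟩ ≤ F(2η) - F(η) ≤ (C(2) - 1) F(η)`, and at `ξ = 0` it gives the lower bound
`⟨F'(η), η⟩ ≥ F(η) - F(0)`. Hence `⟨F'(Du), Du⟩` is integrable on the bounded set `Ω`, and so is
`F*(F'(Du)) = ⟨F'(Du), Du⟩ - F(Du)`, the equality case of the Fenchel–Young inequality
(`fenchelConj_gradient`). Testing Fenchel–Young with unit vectors
gives `|F'(Du)| ≤ F*(F'(Du)) + 2L`, so that `F'(Du)` is even integrable on `Ω`.

Both remaining claims are first variations of the energy in a direction `w` such that `u + t w`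
is a competitor for `0 < t ≤ 1`: `w = φ` is a nonnegative test function, where convexity and
`Δ₂` keep the energy of `u + tφ` finite, or `w = z - u`, where convexity of the obstacle
class suffices. By convexity the difference quotients
`t⁻¹ (F(Du + t Dw) - F(Du))` lie between `⟨F'(Du), Dw⟩` and `F(Du + Dw) - F(Du)`; once both are
integrable, dominated convergence turns minimality into `∫ ⟨F'(Du), Dw⟩ ≥ 0`
(`integral_inner_gradient_nonneg`). For `w = z - u` integrability is Fenchel–Young applied to
`Dz` and to `-Dz`; this is where `F(-Dz) ∈ L¹(Ω)` enters.
-/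

namespace ObstacleProblem

/-! ### Convex functions with a gradient -/

section Convexity

variable {E : Type*} [NormedAddCommGroup E] [InnerProductSpace ℝ E] [CompleteSpace E] {F : E → ℝ}

theorem convexOn_of_inner_gradient_le (hF : ∀ ξ η, inner ℝ (∇ F η) (ξ - η) ≤ F ξ - F η) :
    ConvexOn ℝ Set.univ F := by
  refine ⟨convex_univ, fun ξ _ η _ a b ha hb hab => ?_⟩
  set ζ := a • ξ + b • η
  have h1 := mul_le_mul_of_nonneg_left (hF ξ ζ) ha
  have h2 := mul_le_mul_of_nonneg_left (hF η ζ) hb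
  have h3 : a * inner ℝ (∇ F ζ) (ξ - ζ) + b * inner ℝ (∇ F ζ) (η - ζ) = 0 := by
    rw [← real_inner_smul_right, ← real_inner_smul_right, ← inner_add_right]
    have : a • (ξ - ζ) + b • (η - ζ) = 0 := by
      have : a • (ξ - ζ) + b • (η - ζ) = ζ - (a + b) • ζ := by simp only [ζ]; module
      rw [this, hab, one_smul, sub_self]
    rw [this, inner_zero_right]
  have h4 : F ζ = a * F ζ + b * F ζ := by rw [← add_mul, hab, one_mul]
  simp only [smul_eq_mul]
  linarith

theorem inner_gradient_self_le (hF : ∀ ξ η, inner ℝ (∇ F η) (ξ - η) ≤ F ξ - F η) (η : E) :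
    inner ℝ (∇ F η) η ≤ F ((2 : ℝ) • η) - F η := by
  simpa [two_smul] using hF ((2 : ℝ) • η) η

theorem le_inner_gradient_self (hF : ∀ ξ η, inner ℝ (∇ F η) (ξ - η) ≤ F ξ - F η) (η : E) :
    F η - F 0 ≤ inner ℝ (∇ F η) η := by
  have := hF 0 η
  rw [zero_sub, inner_neg_right] at this
  linarith

/-- The Fenchel–Young inequality at `ζ = F'(η)`, with `F*(F'(η))` written out. -/
theorem inner_gradient_le (hF : ∀ ξ η, inner ℝ (∇ F η) (ξ - η) ≤ F ξ - F η) (ξ η : E) :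
    inner ℝ (∇ F η) ξ ≤ F ξ + (inner ℝ (∇ F η) η - F η) := by
  have := hF ξ η
  rw [inner_sub_right] at this
  linarith

/-- Equality in the Fenchel–Young inequality: `F*(F'(η)) = ⟨F'(η), η⟩ - F(η)`. -/
theorem fenchelConj_gradient {n : ℕ} {F : EuclideanSpace ℝ (Fin n) → ℝ}
    (hF : ∀ ξ η, inner ℝ (∇ F η) (ξ - η) ≤ F ξ - F η) (η : EuclideanSpace ℝ (Fin n)) :
    fenchelConj F (∇ F η) = inner ℝ (∇ F η) η - F η := by
  refine IsGreatest.csSup_eq ⟨⟨η, rfl⟩, ?_⟩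
  rintro _ ⟨ξ, rfl⟩
  have := inner_gradient_le hF ξ η
  dsimp only
  linarith

theorem norm_gradient_le (hF : ∀ ξ η, inner ℝ (∇ F η) (ξ - η) ≤ F ξ - F η) {M : ℝ}
    (hM : ∀ ξ, ‖ξ‖ ≤ 1 → F ξ ≤ M) (η : E) :
    ‖∇ F η‖ ≤ M + (inner ℝ (∇ F η) η - F η) := by
  set ζ := ∇ F η
  -- For `ζ = 0` the vector `‖ζ‖⁻¹ • ζ` is `0`, and both facts below still hold.
  have h1 : ‖‖ζ‖⁻¹ • ζ‖ ≤ 1 := by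
    rw [norm_smul, norm_inv, norm_norm]
    exact inv_mul_le_one
  have h2 : inner ℝ ζ (‖ζ‖⁻¹ • ζ) = ‖ζ‖ := by
    rw [real_inner_smul_right, real_inner_self_eq_norm_sq]
    rcases eq_or_ne ‖ζ‖ 0 with h | h
    · simp [h]
    · field_simp
  have h3 := inner_gradient_le hF (‖ζ‖⁻¹ • ζ) η
  have h4 := hM _ h1
  change inner ℝ ζ _ ≤ _ at h3
  rw [h2] at h3
  linarith

end Convexity

/-! ### The first variation of a convex energy -/

theorem continuous_gradient {E : Type*} [NormedAddCommGroup E] [InnerProductSpace ℝ E]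
    [CompleteSpace E] {F : E → ℝ} (hF : ContDiff ℝ 1 F) : Continuous (∇ F) :=
  (InnerProductSpace.toDual ℝ E).symm.continuous.comp (hF.continuous_fderiv one_ne_zero)

/-- First-order optimality: if `t ↦ ∫ F(f + t g)` on `[0, 1]` is smallest at `t = 0`, then
`∫ ⟨F'(f), g⟩ ≥ 0`. By convexity the difference quotients lie between `⟨F'(f), g⟩` and
`F(f + g) - F(f)`, so dominated convergence applies. -/
theorem integral_inner_gradient_nonneg {E X : Type*} [NormedAddCommGroup E]
    [InnerProductSpace ℝ E] [CompleteSpace E] [MeasurableSpace X] {μ : Measure X} {F : E → ℝ}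
    (hF : ContDiff ℝ 1 F) (hconv : ∀ ξ η, inner ℝ (∇ F η) (ξ - η) ≤ F ξ - F η) {f g : X → E}
    (hf : AEStronglyMeasurable f μ) (hg : AEStronglyMeasurable g μ)
    (hFf : Integrable (fun x => F (f x)) μ) (hFfg : Integrable (fun x => F (f x + g x)) μ)
    (hinner : Integrable (fun x => inner ℝ (∇ F (f x)) (g x)) μ)
    (hmin : ∀ t : ℝ, 0 < t → t ≤ 1 →
      Integrable (fun x => F (f x + t • g x)) μ ∧ ∫ x, F (f x) ∂μ ≤ ∫ x, F (f x + t • g x) ∂μ) :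
    0 ≤ ∫ x, inner ℝ (∇ F (f x)) (g x) ∂μ := by
  have hI : ∀ᶠ t : ℝ in 𝓝[>] 0, 0 < t ∧ t ≤ 1 :=
    Filter.mem_of_superset (Ioc_mem_nhdsGT one_pos) fun t ht => ht
  have hlim : Filter.Tendsto (fun t : ℝ => ∫ x, t⁻¹ • (F (f x + t • g x) - F (f x)) ∂μ) (𝓝[>] 0)
      (𝓝 (∫ x, inner ℝ (∇ F (f x)) (g x) ∂μ)) := by
    refine tendsto_integral_filter_of_dominated_convergence
      (fun x => |inner ℝ (∇ F (f x)) (g x)| + |F (f x + g x) - F (f x)|) ?_ ?_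
      (hinner.abs.add (hFfg.sub hFf).abs) ?_
    · refine Filter.Eventually.of_forall fun t => ?_
      exact ((hF.continuous.comp_aestronglyMeasurable (hf.add (hg.const_smul t))).sub
        (hF.continuous.comp_aestronglyMeasurable hf)).const_smul t⁻¹
    · filter_upwards [hI] with t ht
      refine Filter.Eventually.of_forall fun x => ?_
      have hlow : inner ℝ (∇ F (f x)) (g x) ≤ t⁻¹ • (F (f x + t • g x) - F (f x)) := by
        have := hconv (f x + t • g x) (f x)
        rw [add_sub_cancel_left, real_inner_smul_right] at this
        rw [smul_eq_mul, le_inv_mul_iff₀ ht.1]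
        exact this
      have hup : t⁻¹ • (F (f x + t • g x) - F (f x)) ≤ F (f x + g x) - F (f x) := by
        have := (convexOn_of_inner_gradient_le hconv).2 (Set.mem_univ (f x))
          (Set.mem_univ (f x + g x)) (sub_nonneg.2 ht.2) ht.1.le (by ring)
        rw [show (1 - t) • f x + t • (f x + g x) = f x + t • g x by module] at this
        rw [smul_eq_mul, inv_mul_le_iff₀ ht.1]
        simp only [smul_eq_mul] at this
        linarith
      rw [Real.norm_eq_abs]
      refine (abs_le_max_abs_abs hlow hup).trans ?_
      exact max_le_add_of_nonneg (abs_nonneg _) (abs_nonneg _)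
    · refine Filter.Eventually.of_forall fun x => ?_
      have h := ((hF.differentiable one_ne_zero (f x)).hasFDerivAt.hasLineDerivAt
        (g x)).tendsto_slope_zero_right
      rwa [← inner_gradient_left] at h
  refine ge_of_tendsto hlim ?_
  filter_upwards [hI] with t ht
  obtain ⟨hint, hle⟩ := hmin t ht.1 ht.2
  rw [integral_smul, integral_sub hint hFf]
  exact smul_nonneg (inv_nonneg.2 ht.1.le) (sub_nonneg.2 hle)

/-! ### Linearity of the weak gradient and of `W^{1,p}_0(Ω)` -/

section Sobolev

variable {n : ℕ} {Ω : Opens (EuclideanSpace ℝ (Fin n))}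
  {v w : EuclideanSpace ℝ (Fin n) → ℝ}
  {g h : EuclideanSpace ℝ (Fin n) → EuclideanSpace ℝ (Fin n)} {p : ℝ}

theorem continuous_gradient_testFunction (φ : 𝓓(Ω, ℝ)) : Continuous (∇ φ) :=
  continuous_gradient (φ.contDiff.of_le (by exact_mod_cast le_top))

theorem support_gradient_subset_tsupport (φ : 𝓓(Ω, ℝ)) :
    Function.support (∇ φ) ⊆ tsupport φ := by
  intro x hx
  refine support_fderiv_subset ℝ (f := φ) fun h0 => hx ?_
  simp [gradient, h0]

theorem hasCompactSupport_gradient (φ : 𝓓(Ω, ℝ)) : HasCompactSupport (∇ φ) :=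
  φ.hasCompactSupport.mono' (support_gradient_subset_tsupport φ)

theorem gradient_testFunction_add (φ χ : 𝓓(Ω, ℝ)) (x : EuclideanSpace ℝ (Fin n)) :
    ∇ (φ + χ : 𝓓(Ω, ℝ)) x = ∇ φ x + ∇ χ x := by
  have hd : ∀ φ : 𝓓(Ω, ℝ), DifferentiableAt ℝ φ x := fun φ =>
    φ.contDiff.differentiable (by simp) x
  have : fderiv ℝ (⇑(φ + χ : 𝓓(Ω, ℝ))) x = fderiv ℝ φ x + fderiv ℝ χ x :=
    fderiv_add (hd φ) (hd χ)
  rw [gradient, this, map_add, gradient, gradient]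

theorem gradient_testFunction_smul (c : ℝ) (φ : 𝓓(Ω, ℝ)) (x : EuclideanSpace ℝ (Fin n)) :
    ∇ (c • φ : 𝓓(Ω, ℝ)) x = c • ∇ φ x := by
  have hd : DifferentiableAt ℝ φ x := φ.contDiff.differentiable (by simp) x
  have : fderiv ℝ (⇑(c • φ : 𝓓(Ω, ℝ))) x = c • fderiv ℝ φ x := fderiv_const_smul hd c
  rw [gradient, this, map_smulₛₗ, gradient, RCLike.conj_to_real]

theorem HasWeakGrad.integrableOn_smul_gradient (hv : HasWeakGrad Ω v g) (φ : 𝓓(Ω, ℝ)) :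
    IntegrableOn (fun x => v x • ∇ φ x) Ω volume := by
  have h1 : IntegrableOn (fun x => v x • ∇ φ x) (tsupport φ) volume :=
    (hv.locallyIntegrable.integrableOn_compact_subset φ.tsupport_subset
      φ.hasCompactSupport).smul_continuousOn (continuous_gradient_testFunction φ).continuousOn
      φ.hasCompactSupport
  refine ((integrableOn_iff_integrable_of_support_subset fun x hx =>
    support_gradient_subset_tsupport φ ?_).1 h1).integrableOn
  exact fun h0 => hx (by simp [h0])

theorem HasWeakGrad.integrableOn_smul (hv : HasWeakGrad Ω v g) (φ : 𝓓(Ω, ℝ)) :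
    IntegrableOn (fun x => φ x • g x) Ω volume := by
  have h1 : IntegrableOn (fun x => φ x • g x) (tsupport φ) volume :=
    (hv.locallyIntegrable_grad.integrableOn_compact_subset φ.tsupport_subset
      φ.hasCompactSupport).continuousOn_smul φ.continuous.continuousOn φ.hasCompactSupport
  refine ((integrableOn_iff_integrable_of_support_subset fun x hx => subset_tsupport φ ?_).1
    h1).integrableOn
  exact fun h0 => hx (by simp [h0])

theorem HasWeakGrad.add (hv : HasWeakGrad Ω v g) (hw : HasWeakGrad Ω w h) :
    HasWeakGrad Ω (fun x => v x + w x) (fun x => g x + h x) where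
  locallyIntegrable := hv.locallyIntegrable.add hw.locallyIntegrable
  locallyIntegrable_grad := hv.locallyIntegrable_grad.add hw.locallyIntegrable_grad
  integral_eq φ := by
    simp only [add_smul, smul_add]
    rw [integral_add (hv.integrableOn_smul_gradient φ) (hw.integrableOn_smul_gradient φ),
      integral_add (hv.integrableOn_smul φ) (hw.integrableOn_smul φ), hv.integral_eq,
      hw.integral_eq, neg_add]

theorem HasWeakGrad.const_mul (c : ℝ) (hv : HasWeakGrad Ω v g) :
    HasWeakGrad Ω (fun x => c * v x) (fun x => c • g x) where
  locallyIntegrable := hv.locallyIntegrable.smul c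
  locallyIntegrable_grad := hv.locallyIntegrable_grad.smul c
  integral_eq φ := by
    simp only [mul_smul, smul_comm _ c, integral_smul, hv.integral_eq, smul_neg]

/-- Classical gradients of test functions are weak gradients: integration by parts. -/
theorem hasWeakGrad_testFunction (φ : 𝓓(Ω, ℝ)) : HasWeakGrad Ω φ (∇ φ) where
  locallyIntegrable := φ.continuous.locallyIntegrable.locallyIntegrableOn _
  locallyIntegrable_grad :=
    (continuous_gradient_testFunction φ).locallyIntegrable.locallyIntegrableOn _
  integral_eq χ := by
    have hd : ∀ φ : 𝓓(Ω, ℝ), Differentiable ℝ φ := fun φ => φ.contDiff.differentiable (by simp)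
    have hint : ∀ φ χ : 𝓓(Ω, ℝ), Integrable (fun x => φ x • ∇ χ x) := fun φ χ =>
      (φ.continuous.smul (continuous_gradient_testFunction χ)).integrable_of_hasCompactSupport
        φ.hasCompactSupport.smul_right
    have hset : ∀ φ χ : 𝓓(Ω, ℝ),
        ∫ x in (Ω : Set (EuclideanSpace ℝ (Fin n))), φ x • ∇ χ x = ∫ x, φ x • ∇ χ x := by
      refine fun φ χ => setIntegral_eq_integral_of_forall_compl_eq_zero fun x hx => ?_
      rw [image_eq_zero_of_notMem_tsupport fun hx' => hx (φ.tsupport_subset hx'), zero_smul]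
    rw [hset, hset]
    refine ext_inner_left ℝ fun e => ?_
    have hinner : ∀ φ χ : 𝓓(Ω, ℝ),
        inner ℝ e (∫ x, φ x • ∇ χ x) = ∫ x, φ x * fderiv ℝ χ x e := by
      intro φ χ
      rw [← integral_inner (hint φ χ)]
      refine integral_congr_ae (Filter.Eventually.of_forall fun x => ?_)
      simp only [real_inner_smul_right]
      rw [real_inner_comm, inner_gradient_left]
    have hmul : ∀ φ χ : 𝓓(Ω, ℝ), Integrable (fun x => φ x * fderiv ℝ χ x e) := by
      intro φ χ
      refine ((hint φ χ).const_inner e).congr (Filter.Eventually.of_forall fun x => ?_)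
      simp only [real_inner_smul_right]
      rw [real_inner_comm, inner_gradient_left]
    rw [inner_neg_right, hinner, hinner, integral_mul_fderiv_eq_neg_fderiv_mul_of_integrable]
    · simp only [mul_comm]
    · simpa only [mul_comm] using hmul χ φ
    · exact hmul φ χ
    · exact (φ.continuous.mul χ.continuous).integrable_of_hasCompactSupport
        φ.hasCompactSupport.mul_right
    · exact fun x _ => hd φ x
    · exact fun x _ => hd χ x

theorem HasWeakGrad.weakGrad_ae_eq (hv : HasWeakGrad Ω v g) :
    weakGrad Ω v =ᵐ[volume.restrict (Ω : Set (EuclideanSpace ℝ (Fin n)))] g :=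
  (WeaklyDifferentiable.hasWeakGrad ⟨g, hv⟩).ae_eq hv

/-- Membership in `W^{1,p}_0(Ω)` may be checked on any representative of the weak gradient. -/
theorem HasWeakGrad.memW1p0 (hv : HasWeakGrad Ω v g)
    (hvp : MemLp v (ENNReal.ofReal p) (volume.restrict (Ω : Set (EuclideanSpace ℝ (Fin n)))))
    (hgp : MemLp g (ENNReal.ofReal p) (volume.restrict (Ω : Set (EuclideanSpace ℝ (Fin n)))))
    (φ : ℕ → 𝓓(Ω, ℝ))
    (hφ : Filter.Tendsto (fun k => eLpNorm (fun x => v x - φ k x) (ENNReal.ofReal p)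
      (volume.restrict (Ω : Set (EuclideanSpace ℝ (Fin n))))) Filter.atTop (𝓝 0))
    (hφ' : Filter.Tendsto (fun k => eLpNorm (fun x => g x - ∇ (φ k) x) (ENNReal.ofReal p)
      (volume.restrict (Ω : Set (EuclideanSpace ℝ (Fin n))))) Filter.atTop (𝓝 0)) :
    MemW1p0 p Ω v where
  weaklyDifferentiable := ⟨g, hv⟩
  memLp := hvp
  memLp_grad := hgp.ae_eq hv.weakGrad_ae_eq.symm
  approx := by
    refine ⟨φ, hφ, hφ'.congr fun k => eLpNorm_congr_ae ?_⟩
    filter_upwards [hv.weakGrad_ae_eq] with x hx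
    rw [hx]

theorem memW1p0_testFunction (φ : 𝓓(Ω, ℝ)) : MemW1p0 p Ω φ :=
  (hasWeakGrad_testFunction φ).memW1p0
    ((φ.continuous.memLp_of_hasCompactSupport φ.hasCompactSupport).restrict _)
    (((continuous_gradient_testFunction φ).memLp_of_hasCompactSupport
      (hasCompactSupport_gradient φ)).restrict _)
    (fun _ => φ) (by simp) (by simp)

theorem MemW1p0.add (hp : 1 ≤ p) (hv : MemW1p0 p Ω v) (hw : MemW1p0 p Ω w) :
    MemW1p0 p Ω (fun x => v x + w x) := by
  have hp' : 1 ≤ ENNReal.ofReal p := by simpa using hp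
  obtain ⟨φ, hφ, hφ'⟩ := hv.approx
  obtain ⟨χ, hχ, hχ'⟩ := hw.approx
  refine (hv.weaklyDifferentiable.hasWeakGrad.add hw.weaklyDifferentiable.hasWeakGrad).memW1p0
    (hv.memLp.add hw.memLp) (hv.memLp_grad.add hw.memLp_grad) (fun k => φ k + χ k) ?_ ?_
  · refine tendsto_of_tendsto_of_tendsto_of_le_of_le tendsto_const_nhds
      (by simpa using hφ.add hχ) (fun _ => zero_le) fun k => ?_
    convert! eLpNorm_add_le (hv.memLp.1.sub (φ k).continuous.aestronglyMeasurable)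
      (hw.memLp.1.sub (χ k).continuous.aestronglyMeasurable) hp' using 2
    ext x
    simp
    ring
  · refine tendsto_of_tendsto_of_tendsto_of_le_of_le tendsto_const_nhds
      (by simpa using hφ'.add hχ') (fun _ => zero_le) fun k => ?_
    convert! eLpNorm_add_le
      (hv.memLp_grad.1.sub (continuous_gradient_testFunction (φ k)).aestronglyMeasurable)
      (hw.memLp_grad.1.sub (continuous_gradient_testFunction (χ k)).aestronglyMeasurable)
      hp' using 2
    funext x
    simp only [Pi.add_apply, Pi.sub_apply, gradient_testFunction_add]
    abel

theorem MemW1p0.const_mul (c : ℝ) (hv : MemW1p0 p Ω v) : MemW1p0 p Ω (fun x => c * v x) := by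
  obtain ⟨φ, hφ, hφ'⟩ := hv.approx
  refine (hv.weaklyDifferentiable.hasWeakGrad.const_mul c).memW1p0 (hv.memLp.const_mul c)
    (hv.memLp_grad.const_smul c) (fun k => c • φ k) ?_ ?_
  · have := ENNReal.Tendsto.const_mul (a := ‖c‖ₑ) hφ (Or.inr enorm_ne_top)
    rw [mul_zero] at this
    refine this.congr fun k => ?_
    rw [← eLpNorm_const_smul]
    congr 1
    funext x
    simp [mul_sub]
  · have := ENNReal.Tendsto.const_mul (a := ‖c‖ₑ) hφ' (Or.inr enorm_ne_top)
    rw [mul_zero] at this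
    refine this.congr fun k => ?_
    rw [← eLpNorm_const_smul]
    congr 1
    funext x
    rw [Pi.smul_apply, gradient_testFunction_smul, smul_sub]

end Sobolev

/-! ### The obstacle class -/

section ObstacleClass

variable {n : ℕ} {Ω : Opens (EuclideanSpace ℝ (Fin n))} {p : ℝ}
  {F : EuclideanSpace ℝ (Fin n) → ℝ} {u₀ u z : EuclideanSpace ℝ (Fin n) → ℝ}
  {ψ : EuclideanSpace ℝ (Fin n) → EReal}

theorem hasWeakGrad_of_mem_obstacleClass (hu₀ : WeaklyDifferentiable Ω u₀)
    (hu : u ∈ obstacleClass p Ω F u₀ ψ) : HasWeakGrad Ω u (weakGrad Ω u) := by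
  have := hu.1.weaklyDifferentiable.hasWeakGrad.add hu₀.hasWeakGrad
  simp only [sub_add_cancel] at this
  exact WeaklyDifferentiable.hasWeakGrad ⟨_, this⟩

theorem aestronglyMeasurable_of_hasWeakGrad {v : EuclideanSpace ℝ (Fin n) → ℝ}
    {g : EuclideanSpace ℝ (Fin n) → EuclideanSpace ℝ (Fin n)} (hv : HasWeakGrad Ω v g) :
    AEStronglyMeasurable g (volume.restrict (Ω : Set (EuclideanSpace ℝ (Fin n)))) :=
  hv.locallyIntegrable_grad.aestronglyMeasurable

theorem integrable_comp_of_convexOn {X : Type*} [MeasurableSpace X] {μ : Measure X}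
    (hF : Continuous F) (hF0 : ∀ ξ, 0 ≤ F ξ) (hconv : ConvexOn ℝ Set.univ F)
    {f g : X → EuclideanSpace ℝ (Fin n)} (hf : AEStronglyMeasurable f μ)
    (hg : AEStronglyMeasurable g μ) (hFf : Integrable (fun x => F (f x)) μ)
    (hFg : Integrable (fun x => F (g x)) μ) {a b : ℝ} (ha : 0 ≤ a) (hb : 0 ≤ b)
    (hab : a + b = 1) : Integrable (fun x => F (a • f x + b • g x)) μ := by
  refine ((hFf.const_mul a).add (hFg.const_mul b)).mono'
    (hF.comp_aestronglyMeasurable ((hf.const_smul a).add (hg.const_smul b)))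
    (Filter.Eventually.of_forall fun x => ?_)
  rw [Real.norm_of_nonneg (hF0 _)]
  exact hconv.2 (Set.mem_univ _) (Set.mem_univ _) ha hb hab

theorem add_mem_obstacleClass (hp : 1 ≤ p) (hu₀ : WeaklyDifferentiable Ω u₀)
    (hu : u ∈ obstacleClass p Ω F u₀ ψ) {w : EuclideanSpace ℝ (Fin n) → ℝ}
    {g : EuclideanSpace ℝ (Fin n) → EuclideanSpace ℝ (Fin n)} (hw : MemW1p0 p Ω w)
    (hg : HasWeakGrad Ω w g)
    (hψ : ∀ᵐ x ∂(volume.restrict (Ω : Set (EuclideanSpace ℝ (Fin n)))),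
      ψ x ≤ ((u x + w x : ℝ) : EReal))
    (hF : IntegrableOn (fun x => F (weakGrad Ω u x + g x)) Ω volume) :
    (fun x => u x + w x) ∈ obstacleClass p Ω F u₀ ψ := by
  refine ⟨?_, hψ, hF.congr ?_⟩
  · have := hu.1.add hp hw
    simpa only [sub_add_eq_add_sub] using this
  · filter_upwards [((hasWeakGrad_of_mem_obstacleClass hu₀ hu).add hg).weakGrad_ae_eq] with x hx
    rw [hx]

/-- The variational inequality in a direction `w` with weak gradient `g`. Admissibility of `u + w`
is enough: by convexity of the constraint and of the energy, every `u + t w` with `0 < t ≤ 1` is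
then a competitor. -/
theorem integral_inner_gradient_nonneg_of_isMinimizer (hp : 1 ≤ p) (hF : ContDiff ℝ 1 F)
    (hconv : ∀ ξ η, inner ℝ (∇ F η) (ξ - η) ≤ F ξ - F η) (hF0 : ∀ ξ, 0 ≤ F ξ)
    (hu₀ : WeaklyDifferentiable Ω u₀) (hu : u ∈ obstacleClass p Ω F u₀ ψ)
    (hmin : ∀ z ∈ obstacleClass p Ω F u₀ ψ,
      ∫ x in (Ω : Set (EuclideanSpace ℝ (Fin n))), F (weakGrad Ω u x)
        ≤ ∫ x in (Ω : Set (EuclideanSpace ℝ (Fin n))), F (weakGrad Ω z x))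
    {w : EuclideanSpace ℝ (Fin n) → ℝ}
    {g : EuclideanSpace ℝ (Fin n) → EuclideanSpace ℝ (Fin n)} (hw : MemW1p0 p Ω w)
    (hg : HasWeakGrad Ω w g)
    (hψ : ∀ᵐ x ∂(volume.restrict (Ω : Set (EuclideanSpace ℝ (Fin n)))),
      ψ x ≤ ((u x + w x : ℝ) : EReal))
    (hFg : IntegrableOn (fun x => F (weakGrad Ω u x + g x)) Ω volume)
    (hinner : IntegrableOn (fun x => inner ℝ (∇ F (weakGrad Ω u x)) (g x)) Ω volume) :
    0 ≤ ∫ x in (Ω : Set (EuclideanSpace ℝ (Fin n))), inner ℝ (∇ F (weakGrad Ω u x)) (g x) := by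
  have hDu := hasWeakGrad_of_mem_obstacleClass hu₀ hu
  have hfm := aestronglyMeasurable_of_hasWeakGrad hDu
  have hgm := aestronglyMeasurable_of_hasWeakGrad hg
  refine integral_inner_gradient_nonneg hF hconv hfm hgm hu.2.2 hFg hinner fun t ht ht1 => ?_
  have hint : IntegrableOn (fun x => F (weakGrad Ω u x + t • g x)) Ω volume := by
    refine (integrable_comp_of_convexOn hF.continuous hF0 (convexOn_of_inner_gradient_le hconv)
      hfm (hfm.add hgm) hu.2.2 hFg (sub_nonneg.2 ht1) ht.le (by ring)).congr
      (Filter.Eventually.of_forall fun x => ?_)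
    simp only [Pi.add_apply]
    congr 1
    module
  refine ⟨hint, ?_⟩
  have hψt : ∀ᵐ x ∂(volume.restrict (Ω : Set (EuclideanSpace ℝ (Fin n)))),
      ψ x ≤ ((u x + t * w x : ℝ) : EReal) := by
    filter_upwards [hu.2.1, hψ] with x h0 h1
    rcases le_total 0 (w x) with hwx | hwx
    · refine h0.trans (EReal.coe_le_coe_iff.2 ?_)
      nlinarith
    · refine h1.trans (EReal.coe_le_coe_iff.2 ?_)
      nlinarith
  refine (hmin _ (add_mem_obstacleClass hp hu₀ hu (hw.const_mul t) (hg.const_mul t) hψt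
    hint)).trans_eq (integral_congr_ae ?_)
  filter_upwards [(hDu.add (hg.const_mul t)).weakGrad_ae_eq] with x hx
  rw [hx]

end ObstacleClass

end ObstacleProblem

theorem theorem1p2 (n : ℕ) (hn : 2 ≤ n)
    (Ω : Opens (EuclideanSpace ℝ (Fin n)))
    (hΩ : Bornology.IsBounded (Ω : Set (EuclideanSpace ℝ (Fin n))))
    (p q l L ν : ℝ) (hp : 1 < p) (hpq : p ≤ q) (hl : 0 < l) (hL : l < L) (hν : 0 < ν)
    (F : EuclideanSpace ℝ (Fin n) → ℝ) (hF : ContDiff ℝ 1 F)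
    -- `(p, q)`-growth
    (H1 : ∀ ξ, l * ‖ξ‖ ^ p ≤ F ξ ∧ F ξ ≤ L * (1 + ‖ξ‖ ^ q))
    -- strict convexity in terms of `V_p`
    (H2 : ∀ ξ η, ν * ‖auxV p ξ - auxV p η‖ ^ 2
      ≤ F ξ - F η - inner ℝ (∇ F η) (ξ - η))
    -- the `Δ₂`-type condition
    (H3 : ∃ C : ℝ → ℝ, ∀ r : ℝ, 1 < r → ∀ ξ, F (r • ξ) ≤ C r * F ξ)
    -- the obstacle `ψ : Ω → [-∞, ∞)`, weakly differentiable (so finite a.e.), `F(Dψ) ∈ L¹(Ω)`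
    (ψ : EuclideanSpace ℝ (Fin n) → EReal)
    (hψ_top : ∀ x ∈ Ω, ψ x < ⊤)
    (hψ_bot : ∀ᵐ x ∂(volume.restrict (Ω : Set (EuclideanSpace ℝ (Fin n)))), ψ x ≠ ⊥)
    (hψ_diff : WeaklyDifferentiable Ω (fun x => (ψ x).toReal))
    (hψ : IntegrableOn (fun x => F (weakGrad Ω (fun y => (ψ y).toReal) x)) Ω volume)
    -- the boundary datum, `F(Du₀) ∈ L¹(Ω)`
    (u₀ : EuclideanSpace ℝ (Fin n) → ℝ)
    (hu₀_diff : WeaklyDifferentiable Ω u₀)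
    (hu₀ : IntegrableOn (fun x => F (weakGrad Ω u₀ x)) Ω volume)
    -- the solution of the obstacle problem
    (u : EuclideanSpace ℝ (Fin n) → ℝ)
    (hu : u ∈ obstacleClass p Ω F u₀ ψ)
    (hmin : ∀ z ∈ obstacleClass p Ω F u₀ ψ,
      ∫ x in (Ω : Set (EuclideanSpace ℝ (Fin n))), F (weakGrad Ω u x)
        ≤ ∫ x in (Ω : Set (EuclideanSpace ℝ (Fin n))), F (weakGrad Ω z x)) :
    IntegrableOn (fun x => fenchelConj F (∇ F (weakGrad Ω u x)))
      Ω volume ∧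
    IntegrableOn (fun x => inner ℝ (∇ F (weakGrad Ω u x))
      (weakGrad Ω u x)) Ω volume ∧
    DivNonpos Ω (fun x => ∇ F (weakGrad Ω u x)) ∧
    ∀ z ∈ obstacleClass p Ω F u₀ ψ,
      IntegrableOn (fun x => F (weakGrad Ω z x)) Ω volume →
      IntegrableOn (fun x => F (-weakGrad Ω z x)) Ω volume →
      IntegrableOn (fun x => inner ℝ (∇ F (weakGrad Ω u x))
        (weakGrad Ω z x - weakGrad Ω u x)) Ω volume ∧
      0 ≤ ∫ x in (Ω : Set (EuclideanSpace ℝ (Fin n))),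
        inner ℝ (∇ F (weakGrad Ω u x))
          (weakGrad Ω z x - weakGrad Ω u x) := by
  have hF0 : ∀ ξ, 0 ≤ F ξ := fun ξ => le_trans (by positivity) (H1 ξ).1
  have hconv : ∀ ξ η, inner ℝ (∇ F η) (ξ - η) ≤ F ξ - F η := fun ξ η => by
    have h1 := H2 ξ η
    have h2 : 0 ≤ ν * ‖auxV p ξ - auxV p η‖ ^ 2 := by positivity
    linarith
  have hF1 : ∀ ξ, ‖ξ‖ ≤ 1 → F ξ ≤ 2 * L := fun ξ hξ => by
    have h1 : ‖ξ‖ ^ q ≤ 1 := Real.rpow_le_one (norm_nonneg _) hξ (by linarith)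
    have h2 := (H1 ξ).2
    nlinarith
  obtain ⟨C, hC⟩ := H3
  have hC2 : ∀ ξ, F ((2 : ℝ) • ξ) ≤ C 2 * F ξ := hC 2 one_lt_two
  have : IsFiniteMeasure (volume.restrict (Ω : Set (EuclideanSpace ℝ (Fin n)))) :=
    isFiniteMeasure_restrict.2 hΩ.measure_lt_top.ne
  have hDu := hasWeakGrad_of_mem_obstacleClass hu₀_diff hu
  have hDum := aestronglyMeasurable_of_hasWeakGrad hDu
  have hσm : AEStronglyMeasurable (fun x => ∇ F (weakGrad Ω u x))
      (volume.restrict (Ω : Set (EuclideanSpace ℝ (Fin n)))) :=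
    (continuous_gradient hF).comp_aestronglyMeasurable hDum
  have hself : IntegrableOn (fun x => inner ℝ (∇ F (weakGrad Ω u x)) (weakGrad Ω u x))
      Ω volume := by
    refine integrable_of_le_of_le (hσm.inner hDum)
      (Filter.Eventually.of_forall fun x => le_inner_gradient_self hconv (weakGrad Ω u x))
      (Filter.Eventually.of_forall fun x => (inner_gradient_self_le hconv (weakGrad Ω u x)).trans
        (sub_le_sub_right (hC2 _) _))
      (hu.2.2.sub (integrable_const _)) ((hu.2.2.const_mul _).sub hu.2.2)
  have hconj : IntegrableOn
      (fun x => inner ℝ (∇ F (weakGrad Ω u x)) (weakGrad Ω u x) - F (weakGrad Ω u x)) Ω volume :=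
    hself.sub hu.2.2
  have hσ : IntegrableOn (fun x => ∇ F (weakGrad Ω u x)) Ω volume :=
    ((integrable_const (2 * L)).add hconj).mono' hσm
      (Filter.Eventually.of_forall fun x => norm_gradient_le hconv hF1 _)
  refine ⟨?_, hself, ⟨hσ.locallyIntegrableOn, fun φ hφ => ?_⟩, fun z hz hFz hFz' => ?_⟩
  · simpa only [fenchelConj_gradient hconv] using hconj
  · rw [neg_nonpos]
    have hφc := continuous_gradient_testFunction φ
    obtain ⟨M, hM⟩ := hφc.bounded_above_of_compact_support (hasCompactSupport_gradient φ)
    refine integral_inner_gradient_nonneg_of_isMinimizer hp.le hF hconv hF0 hu₀_diff hu hmin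
      (memW1p0_testFunction φ) (hasWeakGrad_testFunction φ) ?_ ?_ ?_
    · filter_upwards [hu.2.1] with x hx
      exact hx.trans (EReal.coe_le_coe_iff.2 (le_add_of_nonneg_right (hφ x)))
    · -- `Du + Dφ` is the midpoint of `2Du`, where the `Δ₂`-type condition applies, and the
      -- bounded function `2Dφ`.
      have h1 : IntegrableOn (fun x => F ((2 : ℝ) • weakGrad Ω u x)) Ω volume :=
        (hu.2.2.const_mul (C 2)).mono'
          (hF.continuous.comp_aestronglyMeasurable (hDum.const_smul (2 : ℝ)))
          (Filter.Eventually.of_forall fun x => by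
            rw [Real.norm_of_nonneg (hF0 _)]
            exact hC2 _)
      have h2 : IntegrableOn (fun x => F ((2 : ℝ) • ∇ φ x)) Ω volume := by
        refine Integrable.of_bound (hF.continuous.comp (hφc.const_smul
          (2 : ℝ))).aestronglyMeasurable (L * (1 + (2 * M) ^ q))
          (Filter.Eventually.of_forall fun x => ?_)
        rw [Real.norm_of_nonneg (hF0 _)]
        refine (H1 _).2.trans ?_
        rw [norm_smul, Real.norm_ofNat]
        have hL0 : 0 ≤ L := by linarith
        have hq0 : 0 ≤ q := by linarith
        have := hM x
        gcongr
      refine (integrable_comp_of_convexOn hF.continuous hF0 (convexOn_of_inner_gradient_le hconv)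
        (hDum.const_smul (2 : ℝ)) (hφc.const_smul (2 : ℝ)).aestronglyMeasurable h1 h2
        (a := 1 / 2) (b := 1 / 2) (by norm_num) (by norm_num) (by norm_num)).congr
        (Filter.Eventually.of_forall fun x => ?_)
      simp [smul_smul]
    · refine (hσ.norm.mul_const M).mono' (hσm.inner hφc.aestronglyMeasurable)
        (Filter.Eventually.of_forall fun x => ?_)
      exact (norm_inner_le_norm _ _).trans (mul_le_mul_of_nonneg_left (hM x) (norm_nonneg _))
  · have hDz := hasWeakGrad_of_mem_obstacleClass hu₀_diff hz
    have hDzm := aestronglyMeasurable_of_hasWeakGrad hDz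
    have hcross : IntegrableOn (fun x => inner ℝ (∇ F (weakGrad Ω u x)) (weakGrad Ω z x))
        Ω volume := by
      refine integrable_of_le_of_le (hσm.inner hDzm)
        (Filter.Eventually.of_forall fun x => ?_)
        (Filter.Eventually.of_forall fun x => inner_gradient_le hconv (weakGrad Ω z x) _)
        (hFz'.add hconj).neg (hFz.add hconj)
      have := inner_gradient_le hconv (-weakGrad Ω z x) (weakGrad Ω u x)
      rw [inner_neg_right] at this
      simp only [Pi.neg_apply, Pi.add_apply]
      linarith
    have hinner : IntegrableOn (fun x => inner ℝ (∇ F (weakGrad Ω u x))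
        (weakGrad Ω z x - weakGrad Ω u x)) Ω volume := by
      simp only [inner_sub_right]
      exact hcross.sub hself
    refine ⟨hinner, ?_⟩
    have hw : MemW1p0 p Ω (fun x => z x + -1 * u x) := by
      convert! hz.1.add hp.le (hu.1.const_mul (-1)) using 2
      ring
    have hg : HasWeakGrad Ω (fun x => z x + -1 * u x)
        (fun x => weakGrad Ω z x - weakGrad Ω u x) := by
      simpa only [neg_one_smul, ← sub_eq_add_neg] using hDz.add (hDu.const_mul (-1))
    refine integral_inner_gradient_nonneg_of_isMinimizer hp.le hF hconv hF0 hu₀_diff hu hmin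
      hw hg ?_ ?_ hinner
    · filter_upwards [hz.2.1] with x hx
      simpa using hx
    · simpa using hFz
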